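/- **Interior.** Let $a_0,r_b>0$ and let $\psi\in C^\infty((0,a_0),(0,\infty))$ satisfy $\psi(a)/a\to+\infty$ as $a\to0^+$ and $1/\psi\in L^1(0,a_0)$; put $t_s=\int_0^{a_0}\frac{da}{\psi(a)}$. Consider the metric $-dt^2+a(t)^2(dr^2+r^2d\Omega^2)$, $0<t<t_s$, of a collapsing homogeneous scalar field $\phi(t)$ with potential $V$: $a>0$ is continuous and strictly decreasing on $[0,t_s)$, $a(0)=a_0$, and on $(0,t_s)$ $$\dot a^2=\tfrac{8\pi}{3}a^2\epsilon,\qquad \frac{d}{dt}(a^3\dot\phi)=-a^3V'(\phi),\qquad \epsilon=\tfrac12\dot\phi^2+V(\phi)=\tfrac{3}{8\pi}\Big(\frac{\psi(a)}{a}\Big)^2 .$$ The pressure, as a function of $a$, is $p(a)=-\frac{\psi^2(a)}{8\pi a^2}\Big(1+2a\frac{\psi'(a)}{\psi(a)}\Big)$. **Exterior.** An exterior matched at the shell $r=r_b$ is a metric (anisotropic generalization of de Sitter) $$-\chi(Y)\,dT^2+\chi(Y)^{-1}dY^2+Y^2d\Omega^2,\qquad \chi(Y)=1-\frac{2M(Y)}{Y},$$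 with mass function $M$ smooth on $(0,a_0r_b)$, together with $C^2$ functions $T(t)$ and $Y(t)>0$ on $(0,t_s)$, $\dot T>0$, such that the hypersurface $t\mapsto(T(t),Y(t))$ of the exterior and the hypersurface $r=r_b$ of the interior have the same first and second fundamental forms with respect to the outward unit normals (Israel–Darmois junction conditions). **Theorem 5.1.** Assume that $\psi$ is bounded, that $\lim_{a\to0^+}p(a)=-\infty$, and that $1-\psi^2(a(t))r^2$ is bounded away from $0$ uniformly on $(0,r_b)\times(0,t_s)$. Then a matched exterior exists, and for every matched exterior the shell $r=r_b$ collapses to a naked singularity: 1. as $t\to t_s^-$, $Y(t)\to0$ and $T(t)$ tends to a finite limit $T_0$; 2. the energy density diverges at the singular point on both sides: $\epsilon(t)\to+\infty$ as $t\to t_s^-$, and the energy density $-\frac{1}{8\pi}G^T{}_T$ of the exterior metric ($G$ its Einstein tensor) tends to $+\infty$ as $Y\to0^+$; 3. for every $(\theta_0,\varphi_0)$ with $\theta_0\in(0,\pi)$ there is a future-directed outgoing radial null geodesic of the exterior metric, with affine parameter $s\in(0,S)$ for some $S>0$ and angular coordinates constantly $(\theta_0,\varphi_0)$, which tends to the singular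 point $T=T_0$, $Y=0$ as $s\to0^+$ and lies entirely in the exterior region, i.e. at points with $0<Y<a_0r_b$ and $\chi(Y)>0$ such that either $T\ge T_0$, or $T=T(t)$ and $Y>Y(t)$ for some $t\in(0,t_s)$. -/

import Mathlib

open Set Filter Topology
open scoped ContDiff

noncomputable section

namespace ScalarCollapse

/-! ### Pseudo-Riemannian geometry in coordinates -/

/-- Partial derivative of `f` in the `i`-th coordinate at `x`. -/
def pderiv {n : ℕ} (i : Fin n) (f : (Fin n → ℝ) → ℝ) (x : Fin n → ℝ) : ℝ :=
  deriv (fun s => f (Function.update x i s)) (x i)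

/-- A metric tensor on a coordinate patch of a four-dimensional spacetime, given by its matrix of
components `g x i j`. -/
abbrev Metric4 := (Fin 4 → ℝ) → Matrix (Fin 4) (Fin 4) ℝ

/-- Christoffel symbol `Γ^k_{ij}` of the Levi-Civita connection of `g`. -/
def christoffel (g : Metric4) (k i j : Fin 4) (x : Fin 4 → ℝ) : ℝ :=
  (1 / 2) * ∑ l, (g x)⁻¹ k l *
    (pderiv i (fun y => g y j l) x + pderiv j (fun y => g y i l) x - pderiv l (fun y => g y i j) x)

/-- Ricci tensor
`R_{ij} = ∂_k Γ^k_{ij} - ∂_j Γ^k_{ik} + Γ^k_{kl} Γ^l_{ij} - Γ^k_{jl} Γ^l_{ik}`. -/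
def ricci (g : Metric4) (i j : Fin 4) (x : Fin 4 → ℝ) : ℝ :=
  (∑ k, (pderiv k (christoffel g k i j) x - pderiv j (christoffel g k i k) x)) +
    ∑ k, ∑ l, (christoffel g k k l x * christoffel g l i j x -
      christoffel g k j l x * christoffel g l i k x)

/-- Scalar curvature. -/
def scalarCurvature (g : Metric4) (x : Fin 4 → ℝ) : ℝ :=
  ∑ i, ∑ j, (g x)⁻¹ i j * ricci g i j x

/-- Einstein tensor `G_{ij} = R_{ij} - (1/2) R g_{ij}`. -/
def einstein (g : Metric4) (i j : Fin 4) (x : Fin 4 → ℝ) : ℝ :=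
  ricci g i j x - (1 / 2) * scalarCurvature g x * g x i j

/-- Energy density `ε = -T^0_0` of the matter content, where the energy-momentum tensor
`T = G / (8π)` is given by Einstein's equations (`G = c = 1`). -/
def energyDensity (g : Metric4) (x : Fin 4 → ℝ) : ℝ :=
  -(1 / (8 * Real.pi)) * ∑ k, (g x)⁻¹ 0 k * einstein g k 0 x

/-- The curve `γ` is an affinely parametrized geodesic of `g` on the (open) parameter set `I`:
`γ''^k + Γ^k_{ij} γ'^i γ'^j = 0`. -/
def IsGeodesicOn (g : Metric4) (γ : ℝ → Fin 4 → ℝ) (I : Set ℝ) : Prop :=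
  ∀ s ∈ I, DifferentiableAt ℝ γ s ∧ ∀ k, HasDerivAt (fun u => deriv γ u k)
    (-∑ i, ∑ j, christoffel g k i j (γ s) * deriv γ s i * deriv γ s j) s

/-! ### Hypersurfaces and the Israel--Darmois junction conditions -/

/-- First fundamental form induced by `g` on the hypersurface parametrized by `X`. -/
def firstForm (g : Metric4) (X : (Fin 3 → ℝ) → Fin 4 → ℝ) (τ : Fin 3 → ℝ) (α β : Fin 3) : ℝ :=
  ∑ i, ∑ j, g (X τ) i j * pderiv α (fun σ => X σ i) τ * pderiv β (fun σ => X σ j) τ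

/-- The covector `n` is the unit normal covector at `X τ` of the (timelike) hypersurface
parametrized by `X` that points to the side where the second (radial) coordinate increases. -/
def IsOutwardUnitNormal (g : Metric4) (X : (Fin 3 → ℝ) → Fin 4 → ℝ) (τ : Fin 3 → ℝ)
    (n : Fin 4 → ℝ) : Prop :=
  (∀ α, ∑ k, n k * pderiv α (fun σ => X σ k) τ = 0) ∧
    (∑ k, ∑ l, (g (X τ))⁻¹ k l * n k * n l = 1) ∧ 0 < n 1

/-- Second fundamental form, with respect to the normal covector `n`, of the hypersurface
parametrized by `X`: `-n_k (∂_α ∂_β X^k + Γ^k_{ij} ∂_α X^i ∂_β X^j)`. -/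
def secondForm (g : Metric4) (X : (Fin 3 → ℝ) → Fin 4 → ℝ) (τ : Fin 3 → ℝ) (n : Fin 4 → ℝ)
    (α β : Fin 3) : ℝ :=
  -∑ k, n k * (pderiv α (pderiv β (fun σ => X σ k)) τ +
    ∑ i, ∑ j, christoffel g k i j (X τ) *
      pderiv α (fun σ => X σ i) τ * pderiv β (fun σ => X σ j) τ)

/-- Israel--Darmois junction conditions: the first and second fundamental forms induced by the two
spacetimes on the common hypersurface coincide. The second forms are taken with respect to the unit
normals pointing outwards, from the first (interior) to the second (exterior) spacetime. -/
def IsraelDarmois (gInt gExt : Metric4) (XInt XExt : (Fin 3 → ℝ) → Fin 4 → ℝ)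
    (D : Set (Fin 3 → ℝ)) : Prop :=
  ∀ τ ∈ D, firstForm gInt XInt τ = firstForm gExt XExt τ ∧
    ∃ nInt nExt, IsOutwardUnitNormal gInt XInt τ nInt ∧ IsOutwardUnitNormal gExt XExt τ nExt ∧
      secondForm gInt XInt τ nInt = secondForm gExt XExt τ nExt

/-! ### The homogeneous scalar field -/

/-- `ε = φ'² / 2 + V(φ)`. -/
def fieldEnergy (φ V : ℝ → ℝ) (t : ℝ) : ℝ := (1 / 2) * deriv φ t ^ 2 + V (φ t)

/-- The pressure `p(a)` as a function of the scale factor, in terms of the energy profile `ψ`. -/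
def pressure (ψ : ℝ → ℝ) (x : ℝ) : ℝ :=
  -(ψ x ^ 2 / (8 * Real.pi * x ^ 2)) * (1 + 2 * x * (deriv ψ x / ψ x))

/-- Interior metric `-dt² + a(t)² (dr² + r² dΩ²)` in the coordinates `(t, r, θ, ϕ)`. -/
def interiorMetric (a : ℝ → ℝ) : Metric4 := fun x =>
  Matrix.diagonal ![-1, a (x 0) ^ 2, (a (x 0) * x 1) ^ 2, (a (x 0) * x 1 * Real.sin (x 2)) ^ 2]

/-- A homogeneous scalar field `φ` with potential `V` and decreasing scale factor `a`, `a(0) = a₀`,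
solving the Einstein and Klein--Gordon equations for `0 < t < ts`, whose energy density as a
function of `a` is `(3 / 8π) (ψ(a) / a)²`. Here `ψ` is smooth and positive on `(0, a₀)`,
`ψ(a) / a → ∞` as `a → 0⁺`, and `1 / ψ` is integrable, with `ts = ∫₀^{a₀} da / ψ(a)`. -/
structure IsCollapsingScalarField (a₀ ts : ℝ) (ψ a φ V : ℝ → ℝ) : Prop where
  a₀_pos : 0 < a₀
  ψ_smooth : ContDiffOn ℝ ∞ ψ (Ioo 0 a₀)
  ψ_pos : ∀ x ∈ Ioo 0 a₀, 0 < ψ x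
  ψ_div : Tendsto (fun x => ψ x / x) (𝓝[>] 0) atTop
  integrable : MeasureTheory.IntegrableOn (fun x => 1 / ψ x) (Ioo 0 a₀)
  ts_eq : ts = ∫ x in Ioo 0 a₀, 1 / ψ x
  a_zero : a 0 = a₀
  a_cont : ContinuousOn a (Ico 0 ts)
  a_pos : ∀ t ∈ Ico 0 ts, 0 < a t
  a_anti : StrictAntiOn a (Ico 0 ts)
  a_diff : ∀ t ∈ Ioo 0 ts, DifferentiableAt ℝ a t
  φ_diff : ∀ t ∈ Ioo 0 ts, DifferentiableAt ℝ φ t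
  V_diff : ∀ t ∈ Ioo 0 ts, DifferentiableAt ℝ V (φ t)
  einstein_eq : ∀ t ∈ Ioo 0 ts,
    deriv a t ^ 2 = (8 * Real.pi / 3) * a t ^ 2 * fieldEnergy φ V t
  kleinGordon : ∀ t ∈ Ioo 0 ts,
    HasDerivAt (fun s => a s ^ 3 * deriv φ s) (-(a t ^ 3 * deriv V (φ t))) t
  energy_eq : ∀ t ∈ Ioo 0 ts,
    fieldEnergy φ V t = 3 / (8 * Real.pi) * (ψ (a t) / a t) ^ 2

/-! ### The exterior -/

/-- `χ(Y) = 1 - 2 M(Y) / Y`. -/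
def chi (M : ℝ → ℝ) (Y : ℝ) : ℝ := 1 - 2 * M Y / Y

/-- Anisotropic generalization of the de Sitter metric, `-χ dT² + χ⁻¹ dY² + Y² dΩ²`, in the
coordinates `(T, Y, θ, ϕ)`. -/
def exteriorMetric (M : ℝ → ℝ) : Metric4 := fun x =>
  Matrix.diagonal ![-chi M (x 1), (chi M (x 1))⁻¹, x 1 ^ 2, (x 1 * Real.sin (x 2)) ^ 2]

/-- The metric with mass function `M` is matched with the interior at the shell `r = rb`, seen from
the exterior as the hypersurface `t ↦ (T(t), Y(t))`. The Israel--Darmois conditions hold along the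
whole collapse `0 < t < ts`, and `T` and `t` define the same time orientation. -/
structure IsMatched (a₀ ts rb : ℝ) (a M T Y : ℝ → ℝ) : Prop where
  M_smooth : ContDiffOn ℝ ∞ M (Ioo 0 (a₀ * rb))
  T_smooth : ContDiffOn ℝ 2 T (Ioo 0 ts)
  Y_smooth : ContDiffOn ℝ 2 Y (Ioo 0 ts)
  Y_pos : ∀ t ∈ Ioo 0 ts, 0 < Y t
  T_future : ∀ t ∈ Ioo 0 ts, 0 < deriv T t
  junction : IsraelDarmois (interiorMetric a) (exteriorMetric M)
    (fun τ => ![τ 0, rb, τ 1, τ 2]) (fun τ => ![T (τ 0), Y (τ 0), τ 1, τ 2])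
    {τ | τ 0 ∈ Ioo 0 ts ∧ τ 1 ∈ Ioo 0 Real.pi}

/-- The part of the exterior spacetime with areal radius `Y < Ymax`, in the region `χ > 0` where
`T` is a time coordinate: at a time `T(t)` with `0 < t < ts` these are the points outside the shell,
and from the time `T₀` on, when the shell has collapsed, all points with `Y > 0`. -/
def exteriorRegion (ts Ymax T₀ : ℝ) (M T Y : ℝ → ℝ) : Set (Fin 4 → ℝ) :=
  {x | x 1 ∈ Ioo 0 Ymax ∧ x 2 ∈ Ioo 0 Real.pi ∧ 0 < chi M (x 1) ∧
    (T₀ ≤ x 0 ∨ ∃ t ∈ Ioo 0 ts, x 0 = T t ∧ Y t < x 1)}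

/-- `γ`, restricted to `(0, S)`, is a future-directed outgoing radial null geodesic that lies in the
region `E` and starts (as the parameter tends to `0⁺`) from `T = T₀`, `Y = 0` in the direction
`(θ₀, ϕ₀)`. -/
structure IsRadialNullGeodesicFrom (g : Metric4) (E : Set (Fin 4 → ℝ)) (T₀ θ₀ ϕ₀ S : ℝ)
    (γ : ℝ → Fin 4 → ℝ) : Prop where
  geodesic : IsGeodesicOn g γ (Ioo 0 S)
  null : ∀ s ∈ Ioo 0 S, ∑ i, ∑ j, g (γ s) i j * deriv γ s i * deriv γ s j = 0
  radial : ∀ s ∈ Ioo 0 S, γ s 2 = θ₀ ∧ γ s 3 = ϕ₀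
  future : ∀ s ∈ Ioo 0 S, 0 < deriv γ s 0
  outgoing : ∀ s ∈ Ioo 0 S, 0 < deriv γ s 1
  mem : ∀ s ∈ Ioo 0 S, γ s ∈ E
  start : Tendsto γ (𝓝[>] 0) (𝓝 ![T₀, 0, θ₀, ϕ₀])

/-- The shell `r = rb` collapses to a naked singularity: as `t → ts⁻` it reaches `Y = 0` at a
finite exterior time `T₀`, the energy density diverges there on both sides of the shell, and a
future-directed radial null geodesic (in each angular direction) starts from the singular point
`T = T₀`, `Y = 0` and escapes into the exterior. -/
def CollapsesToNakedSingularity (a₀ ts rb : ℝ) (φ V M T Y : ℝ → ℝ) : Prop :=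
  ∃ T₀ : ℝ,
    Tendsto T (𝓝[<] ts) (𝓝 T₀) ∧ Tendsto Y (𝓝[<] ts) (𝓝 0) ∧
    Tendsto (fieldEnergy φ V) (𝓝[<] ts) atTop ∧
    (∀ T₁ : ℝ, ∀ θ ∈ Ioo 0 Real.pi, ∀ ϕ : ℝ,
      Tendsto (fun y => energyDensity (exteriorMetric M) ![T₁, y, θ, ϕ]) (𝓝[>] 0) atTop) ∧
    ∀ θ₀ ∈ Ioo 0 Real.pi, ∀ ϕ₀ : ℝ, ∃ S > 0, ∃ γ : ℝ → Fin 4 → ℝ,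
      IsRadialNullGeodesicFrom (exteriorMetric M) (exteriorRegion ts (a₀ * rb) T₀ M T Y)
        T₀ θ₀ ϕ₀ S γ

end ScalarCollapse

end

/-!
The junction conditions determine the function `χ` of the exterior, and it satisfies `χ ≥ δ > 0`
up to the centre; everything else follows from that.

*Interior.* The field equations give `ȧ² = ψ(a)²`, so `ȧ = -ψ(a)` since `a` decreases. Hence
`∫₀^{a(t)} du / ψ(u) = ts - t` (`integral_scale`), which shows that `a(t) → 0` as `t → ts` and
that `a` takes every value in `(0, a₀)`.

*Junction.* The angular first forms give `Y = a rb`. The angular second forms give `n_Y χ = 1` for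
the exterior normal, so `χ > 0`, and normalization then forces `χ(Y) = 1 - Ẏ²` and `Ṫ = 1 / χ(Y)`
(`eq_of_junction`). As `Ẏ = -ψ(a) rb`, this determines `χ(y) = 1 - ψ(y / rb)² rb²` on `(0, a₀ rb)`.
Conversely, differentiating `Ẏ² = 1 - χ(Y)` and `Ṫ = 1 / χ(Y)` shows that the remaining `tt`
component of the second form vanishes, as it does in the interior (`junction_of_eq`), so a matched exterior
exists.

*Bound on `χ`.* For fixed `t`, the function `r ↦ 1 - ψ² r²` is continuous, equals `1` at `r = 0`,
and stays at distance at least `δ` from `0`, so it is at least `δ` at `r = rb` (`le_of_forall_le_abs`). Hence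
`0 < Ṫ ≤ 1 / δ`, and `T` has a finite limit `T₀`.

*Energy density.* For `-χ dT² + χ⁻¹ dY² + Y² dΩ²` the energy density is `(1 - χ - Y χ') / (8π Y²)`
(`energyDensity_static`); for the matched `χ` this is `-p(Y / rb)`, which tends to `+∞`.

*Visibility.* The null curve `Y = s`, `T = T₀ + ∫₀^s dy / χ(y)` is an affinely parametrized
geodesic. The integral converges because `χ ≥ δ`, and `T ≥ T₀` puts the whole curve in the exterior region
(`isRadialNullGeodesicFrom`).
-/

open Set Filter Topology
open scoped ContDiff

namespace ScalarCollapse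

/-! ### Christoffel symbols of diagonal and static metrics -/

lemma pderiv_congr {n : ℕ} {F G : (Fin n → ℝ) → ℝ} {x : Fin n → ℝ} (k : Fin n)
    (h : F =ᶠ[𝓝 x] G) : pderiv k F x = pderiv k G x := by
  have hc : Tendsto (fun s => Function.update x k s) (𝓝 (x k)) (𝓝 x) := by
    have : Continuous fun s : ℝ => Function.update x k s := by fun_prop
    simpa using this.tendsto (x k)
  have h' : ∀ᶠ s in 𝓝 (x k), F (Function.update x k s) = G (Function.update x k s) :=
    hc.eventually h
  exact Filter.EventuallyEq.deriv_eq h'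

lemma pderiv_eq_of_hasDerivAt {n : ℕ} {F : (Fin n → ℝ) → ℝ} {x : Fin n → ℝ} {k : Fin n}
    {h : ℝ → ℝ} {c : ℝ} (hF : ∀ s, F (Function.update x k s) = h s) (hd : HasDerivAt h c (x k)) :
    pderiv k F x = c := by
  simp only [pderiv, hF]
  exact hd.deriv

lemma inv_diagonal {v : Fin 4 → ℝ} (hv : ∀ i, v i ≠ 0) :
    (Matrix.diagonal v)⁻¹ = Matrix.diagonal fun i => (v i)⁻¹ := by
  refine Matrix.inv_eq_right_inv ?_
  rw [Matrix.diagonal_mul_diagonal]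
  simp [hv]

lemma christoffel_diagonal (d : (Fin 4 → ℝ) → Fin 4 → ℝ) {x : Fin 4 → ℝ}
    (hx : ∀ i, d x i ≠ 0) (k i j : Fin 4) :
    christoffel (fun y => Matrix.diagonal (d y)) k i j x =
      (1 / 2) * (d x k)⁻¹ * ((if j = k then pderiv i (fun y => d y k) x else 0) +
        (if i = k then pderiv j (fun y => d y k) x else 0) -
        (if i = j then pderiv k (fun y => d y i) x else 0)) := by
  have hinv : (Matrix.diagonal (d x))⁻¹ = Matrix.diagonal fun i => (d x i)⁻¹ := inv_diagonal hx
  have hp : ∀ i j l : Fin 4, pderiv i (fun y => Matrix.diagonal (d y) j l) x =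
      if j = l then pderiv i (fun y => d y l) x else 0 := by
    intro i j l
    by_cases h : j = l
    · subst h; simp
    · simp [h, pderiv]
  simp only [christoffel, hinv, hp]
  rw [Finset.sum_eq_single k]
  · by_cases h : i = j
    · subst h; simp [mul_assoc]
    · simp [h, mul_assoc]
  · intro l _ hl
    rw [Matrix.diagonal_apply_ne _ hl.symm, zero_mul]
  · simp

/-- Diagonal components of the static metric `-f dT² + f⁻¹ dY² + Y² dΩ²` in the coordinates
`(T, Y, θ, ϕ)`; `exteriorMetric M` is definitionally the case `f = chi M`. -/
noncomputable def staticComponents (f : ℝ → ℝ) (x : Fin 4 → ℝ) : Fin 4 → ℝ :=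
  ![-f (x 1), (f (x 1))⁻¹, x 1 ^ 2, (x 1 * Real.sin (x 2)) ^ 2]

/-- Table of the Christoffel symbols of `-f dT² + f⁻¹ dY² + Y² dΩ²`: the entry `i j` of the `k`-th
matrix is `Γ^k_{ij}`. -/
noncomputable def staticChristoffel (f : ℝ → ℝ) (k : Fin 4) (x : Fin 4 → ℝ) :
    Matrix (Fin 4) (Fin 4) ℝ :=
  ![!![0, deriv f (x 1) / (2 * f (x 1)), 0, 0; deriv f (x 1) / (2 * f (x 1)), 0, 0, 0;
      0, 0, 0, 0; 0, 0, 0, 0],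
    Matrix.diagonal ![f (x 1) * deriv f (x 1) / 2, -(deriv f (x 1) / (2 * f (x 1))),
      -(f (x 1) * x 1), -(f (x 1) * x 1 * Real.sin (x 2) ^ 2)],
    !![0, 0, 0, 0; 0, 0, (x 1)⁻¹, 0; 0, (x 1)⁻¹, 0, 0; 0, 0, 0, -(Real.sin (x 2) * Real.cos (x 2))],
    !![0, 0, 0, 0; 0, 0, 0, (x 1)⁻¹; 0, 0, 0, Real.cos (x 2) / Real.sin (x 2);
      0, (x 1)⁻¹, Real.cos (x 2) / Real.sin (x 2), 0]] k

lemma staticComponents_ne_zero {f : ℝ → ℝ} {x : Fin 4 → ℝ} (hf : f (x 1) ≠ 0) (h1 : x 1 ≠ 0)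
    (h2 : Real.sin (x 2) ≠ 0) (i : Fin 4) : staticComponents f x i ≠ 0 := by
  fin_cases i <;> simp [staticComponents, hf, h1, h2]

lemma christoffel_static {f : ℝ → ℝ} {x : Fin 4 → ℝ} (hd : DifferentiableAt ℝ f (x 1))
    (hf : f (x 1) ≠ 0) (h1 : x 1 ≠ 0) (h2 : Real.sin (x 2) ≠ 0) (k i j : Fin 4) :
    christoffel (fun y => Matrix.diagonal (staticComponents f y)) k i j x =
      staticChristoffel f k x i j := by
  rw [christoffel_diagonal _ (staticComponents_ne_zero hf h1 h2)]
  have e0 : pderiv 1 (fun y => staticComponents f y 0) x = -deriv f (x 1) :=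
    pderiv_eq_of_hasDerivAt (fun s => by simp [staticComponents]) hd.hasDerivAt.neg
  have e1 : pderiv 1 (fun y => staticComponents f y 1) x = -deriv f (x 1) / f (x 1) ^ 2 :=
    pderiv_eq_of_hasDerivAt (fun s => by simp [staticComponents]) (hd.hasDerivAt.inv hf)
  have e2 : pderiv 1 (fun y => staticComponents f y 2) x = 2 * x 1 :=
    pderiv_eq_of_hasDerivAt (fun s => by simp [staticComponents]; rfl)
      (by simpa using hasDerivAt_pow 2 (x 1))
  have e3 : pderiv 1 (fun y => staticComponents f y 3) x = 2 * x 1 * Real.sin (x 2) ^ 2 :=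
    pderiv_eq_of_hasDerivAt (h := fun s => s ^ 2 * Real.sin (x 2) ^ 2)
      (fun s => by simp [staticComponents, mul_pow])
      (by simpa using (hasDerivAt_pow 2 (x 1)).mul_const _)
  have e4 : pderiv 2 (fun y => staticComponents f y 3) x =
      x 1 ^ 2 * (2 * Real.sin (x 2) * Real.cos (x 2)) :=
    pderiv_eq_of_hasDerivAt (h := fun s => x 1 ^ 2 * Real.sin s ^ 2)
      (fun s => by simp [staticComponents, mul_pow])
      (by simpa using ((Real.hasDerivAt_sin (x 2)).pow 2).const_mul (x 1 ^ 2))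
  have z : ∀ i k : Fin 4, ¬ (i = 1 ∨ (i = 2 ∧ k = 3)) →
      pderiv i (fun y => staticComponents f y k) x = 0 := by
    intro i k h
    refine pderiv_eq_of_hasDerivAt (h := fun _ => staticComponents f x k) ?_ (hasDerivAt_const _ _)
    intro s
    fin_cases i <;> fin_cases k <;> simp_all [staticComponents]
  have z0 := fun k => z 0 k (by simp)
  have z3 := fun k => z 3 k (by simp)
  have z20 := z 2 0 (by decide)
  have z21 := z 2 1 (by decide)
  have z22 := z 2 2 (by decide)
  fin_cases k <;> fin_cases i <;> fin_cases j <;>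
    simp [e0, e1, e2, e3, e4, z0, z3, z20, z21, z22, staticChristoffel] <;>
    simp [staticComponents] <;> try field_simp

/-! ### Curvature of static spherically symmetric metrics -/

/-- The table of Christoffel symbols is valid near `x`, so it may be differentiated. -/
lemma pderiv_christoffel_static {f : ℝ → ℝ} {x : Fin 4 → ℝ}
    (hd : ∀ᶠ y in 𝓝 (x 1), DifferentiableAt ℝ f y)
    (hf : f (x 1) ≠ 0) (h1 : x 1 ≠ 0) (h2 : Real.sin (x 2) ≠ 0) (l k i j : Fin 4) :
    pderiv l (christoffel (fun y => Matrix.diagonal (staticComponents f y)) k i j) x =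
      pderiv l (fun y => staticChristoffel f k y i j) x := by
  have c1 : ContinuousAt (fun y : Fin 4 → ℝ => y 1) x := (continuous_apply 1).continuousAt
  have c2 : ContinuousAt (fun y : Fin 4 → ℝ => Real.sin (y 2)) x :=
    (Real.continuous_sin.comp (continuous_apply 2)).continuousAt
  have cf : ContinuousAt (fun y : Fin 4 → ℝ => f (y 1)) x :=
    ContinuousAt.comp (f := fun y : Fin 4 → ℝ => y 1) hd.self_of_nhds.continuousAt c1
  apply pderiv_congr
  filter_upwards [c1.eventually hd, cf.eventually_ne hf, c1.eventually_ne h1,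
    c2.eventually_ne h2] with y a b c d
  exact christoffel_static a b c d k i j

/-- Diagonal Ricci components; these suffice for the mixed component `G^T_T`, since the metric is
diagonal. -/
lemma ricci_static {f : ℝ → ℝ} {x : Fin 4 → ℝ}
    (hd : ∀ᶠ y in 𝓝 (x 1), DifferentiableAt ℝ f y) (hd2 : DifferentiableAt ℝ (deriv f) (x 1))
    (hf : f (x 1) ≠ 0) (h1 : x 1 ≠ 0) (h2 : Real.sin (x 2) ≠ 0) (i : Fin 4) :
    ricci (fun y => Matrix.diagonal (staticComponents f y)) i i x =
      (![f (x 1) * (deriv (deriv f) (x 1) / 2 + deriv f (x 1) / x 1),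
        -(deriv (deriv f) (x 1) / 2 + deriv f (x 1) / x 1) / f (x 1),
        1 - f (x 1) - x 1 * deriv f (x 1),
        (1 - f (x 1) - x 1 * deriv f (x 1)) * Real.sin (x 2) ^ 2] : Fin 4 → ℝ) i := by
  have hda := hd.self_of_nhds.hasDerivAt
  have hq := hd2.hasDerivAt.div (hda.const_mul 2) (mul_ne_zero two_ne_zero hf)
  have hi := hasDerivAt_inv h1
  have p0 : ∀ k i j : Fin 4, pderiv 0 (fun y => staticChristoffel f k y i j) x = 0 := by
    intro k i j
    refine pderiv_eq_of_hasDerivAt (h := fun _ => staticChristoffel f k x i j) ?_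
      (hasDerivAt_const _ _)
    intro s
    simp [staticChristoffel]
  have p3 : ∀ k i j : Fin 4, pderiv 3 (fun y => staticChristoffel f k y i j) x = 0 := by
    intro k i j
    refine pderiv_eq_of_hasDerivAt (h := fun _ => staticChristoffel f k x i j) ?_
      (hasDerivAt_const _ _)
    intro s
    simp [staticChristoffel]
  have pz : ∀ l : Fin 4, pderiv l (fun _ : Fin 4 → ℝ => (0 : ℝ)) x = 0 := fun l =>
    pderiv_eq_of_hasDerivAt (fun s => rfl) (hasDerivAt_const _ _)
  have q00 : pderiv 1 (fun y => f (y 1) * deriv f (y 1) / 2) x =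
      (deriv f (x 1) * deriv f (x 1) + f (x 1) * deriv (deriv f) (x 1)) / 2 :=
    pderiv_eq_of_hasDerivAt (fun s => by simp)
      ((hda.mul hd2.hasDerivAt).div_const 2)
  have qq : pderiv 1 (fun y => deriv f (y 1) / (2 * f (y 1))) x = _ :=
    pderiv_eq_of_hasDerivAt (fun s => by simp) hq
  have qi : pderiv 1 (fun y => (y 1)⁻¹) x = _ :=
    pderiv_eq_of_hasDerivAt (fun s => by simp) hi
  have q22 : pderiv 1 (fun y => -(f (y 1) * y 1)) x = _ :=
    pderiv_eq_of_hasDerivAt (fun s => by simp) (hda.mul (hasDerivAt_id _)).neg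
  have q33 : pderiv 1 (fun y => -(f (y 1) * y 1 * Real.sin (y 2) ^ 2)) x = _ :=
    pderiv_eq_of_hasDerivAt (fun s => by simp)
      ((hda.mul (hasDerivAt_id _)).mul_const (Real.sin (x 2) ^ 2)).neg
  have r33 : pderiv 2 (fun y => -(Real.sin (y 2) * Real.cos (y 2))) x = _ :=
    pderiv_eq_of_hasDerivAt (fun s => by simp)
      ((Real.hasDerivAt_sin (x 2)).mul (Real.hasDerivAt_cos (x 2))).neg
  have rcot : pderiv 2 (fun y => Real.cos (y 2) / Real.sin (y 2)) x = _ :=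
    pderiv_eq_of_hasDerivAt (fun s => by simp)
      ((Real.hasDerivAt_cos (x 2)).div (Real.hasDerivAt_sin (x 2)) h2)
  simp only [ricci, christoffel_static hd.self_of_nhds hf h1 h2,
    pderiv_christoffel_static hd hf h1 h2, Fin.sum_univ_four]
  have sc : Real.cos (x 2) ^ 2 = 1 - Real.sin (x 2) ^ 2 := Real.cos_sq' _
  fin_cases i <;>
    simp [p0, p3] <;>
    simp [staticChristoffel, pz, qq, qi, q22, q33, r33, rcot, q00] <;>
    field_simp <;> (try simp only [sc]) <;> ring

lemma energyDensity_static {f : ℝ → ℝ} {x : Fin 4 → ℝ}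
    (hd : ∀ᶠ y in 𝓝 (x 1), DifferentiableAt ℝ f y) (hd2 : DifferentiableAt ℝ (deriv f) (x 1))
    (hf : f (x 1) ≠ 0) (h1 : x 1 ≠ 0) (h2 : Real.sin (x 2) ≠ 0) :
    energyDensity (fun y => Matrix.diagonal (staticComponents f y)) x =
      (1 - f (x 1) - x 1 * deriv f (x 1)) / (8 * Real.pi * x 1 ^ 2) := by
  have hinv : (Matrix.diagonal (staticComponents f x))⁻¹ =
      Matrix.diagonal fun i => (staticComponents f x i)⁻¹ :=
    inv_diagonal (staticComponents_ne_zero hf h1 h2)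
  have hpi := Real.pi_ne_zero
  simp only [energyDensity, einstein, scalarCurvature, hinv, Fin.sum_univ_four]
  simp [ricci_static hd hd2 hf h1 h2]
  simp [staticComponents]
  field_simp
  ring

/-! ### Dynamics of the scale factor -/

/-- The quantity `1 - c r²` starts at `1` and cannot cross `0`, so a bound on its absolute value is
a bound on itself, also at the endpoint `r = rb`. -/
lemma le_of_forall_le_abs {c rb δ : ℝ} (hrb : 0 < rb) (hδ : 0 < δ)
    (h : ∀ r ∈ Ioo 0 rb, δ ≤ |1 - c * r ^ 2|) : δ ≤ 1 - c * rb ^ 2 := by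
  have hc : Continuous fun r : ℝ => 1 - c * r ^ 2 := by fun_prop
  have hlim : δ ≤ |1 - c * rb ^ 2| := by
    have h1 : Tendsto (fun r : ℝ => |1 - c * r ^ 2|) (𝓝[<] rb) (𝓝 |1 - c * rb ^ 2|) :=
      (hc.abs.tendsto rb).mono_left nhdsWithin_le_nhds
    refine ge_of_tendsto h1 ?_
    filter_upwards [Ioo_mem_nhdsLT hrb] with r hr using h r hr
  rcases le_or_gt 0 (1 - c * rb ^ 2) with h0 | h0
  · rwa [abs_of_nonneg h0] at hlim
  -- A negative value at `rb` would force a zero in between.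
  · obtain ⟨r, hr, hr0⟩ := intermediate_value_Ioo' hrb.le hc.continuousOn
      (show (0 : ℝ) ∈ Ioo (1 - c * rb ^ 2) (1 - c * 0 ^ 2) from ⟨h0, by norm_num⟩)
    have := h r hr
    simp only at hr0
    rw [hr0, abs_zero] at this
    exact absurd this (not_le.mpr hδ)

namespace IsCollapsingScalarField

variable {a₀ ts : ℝ} {ψ a φ V : ℝ → ℝ}

lemma scale_mem (h : IsCollapsingScalarField a₀ ts ψ a φ V) {t : ℝ} (ht : t ∈ Ioo 0 ts) :
    a t ∈ Ioo 0 a₀ := by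
  refine ⟨h.a_pos t (Ioo_subset_Ico_self ht), ?_⟩
  rw [← h.a_zero]
  exact h.a_anti ⟨le_rfl, ht.1.trans ht.2⟩ (Ioo_subset_Ico_self ht) ht.1

lemma hasDerivAt_scale (h : IsCollapsingScalarField a₀ ts ψ a φ V) {t : ℝ} (ht : t ∈ Ioo 0 ts) :
    HasDerivAt a (-ψ (a t)) t := by
  have hm := h.scale_mem ht
  have hψ := h.ψ_pos _ hm
  have hsq : deriv a t ^ 2 = ψ (a t) ^ 2 := by
    have ha := hm.1.ne'
    have := Real.pi_ne_zero
    rw [h.einstein_eq t ht, h.energy_eq t ht]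
    field_simp
  have hle : deriv a t ≤ 0 := by
    have hanti : AntitoneOn a (Ioo 0 ts) := h.a_anti.antitoneOn.mono Ioo_subset_Ico_self
    have := hanti.derivWithin_nonpos (x := t)
    rwa [derivWithin_of_isOpen isOpen_Ioo ht] at this
  have : deriv a t = -ψ (a t) := by
    rcases sq_eq_sq_iff_eq_or_eq_neg.mp hsq with h1 | h1
    · linarith
    · exact h1
  exact this ▸ (h.a_diff t ht).hasDerivAt

/-- The integrand is controlled on the open interval `(0, a₀)` only; the endpoints are null. -/
lemma intervalIntegrable (h : IsCollapsingScalarField a₀ ts ψ a φ V) {x : ℝ}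
    (hx : x ∈ Icc 0 a₀) : IntervalIntegrable (fun u => 1 / ψ u) MeasureTheory.volume 0 x := by
  rw [intervalIntegrable_iff_integrableOn_Ioo_of_le hx.1]
  exact h.integrable.mono_set (Ioo_subset_Ioo_right hx.2)

lemma integral_pos (h : IsCollapsingScalarField a₀ ts ψ a φ V) {x : ℝ} (hx : x ∈ Ioc 0 a₀) :
    0 < ∫ u in (0 : ℝ)..x, 1 / ψ u :=
  intervalIntegral.intervalIntegral_pos_of_pos_on (h.intervalIntegrable (Ioc_subset_Icc_self hx))
    (fun u hu => one_div_pos.mpr (h.ψ_pos u ⟨hu.1, hu.2.trans_le hx.2⟩)) hx.1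

lemma ts_eq_intervalIntegral (h : IsCollapsingScalarField a₀ ts ψ a φ V) :
    ts = ∫ u in (0 : ℝ)..a₀, 1 / ψ u := by
  rw [h.ts_eq, intervalIntegral.integral_of_le h.a₀_pos.le,
    MeasureTheory.integral_Ioc_eq_integral_Ioo]

lemma ts_pos (h : IsCollapsingScalarField a₀ ts ψ a φ V) : 0 < ts := by
  rw [h.ts_eq_intervalIntegral]
  exact h.integral_pos ⟨h.a₀_pos, le_rfl⟩

/-- The implicit solution `∫₀^{a(t)} du / ψ(u) = ts - t` of `ȧ = -ψ(a)`. -/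
lemma integral_scale (h : IsCollapsingScalarField a₀ ts ψ a φ V) {t : ℝ} (ht : t ∈ Ico 0 ts) :
    ∫ u in (0 : ℝ)..a t, 1 / ψ u = ts - t := by
  have hmem : ∀ s ∈ Ico 0 ts, a s ∈ Icc 0 a₀ := fun s hs =>
    ⟨(h.a_pos s hs).le, h.a_zero ▸ h.a_anti.antitoneOn ⟨le_rfl, h.ts_pos⟩ hs hs.1⟩
  have hψc : ContinuousOn (fun u => 1 / ψ u) (Ioo 0 a₀) :=
    continuousOn_const.div h.ψ_smooth.continuousOn fun u hu => (h.ψ_pos u hu).ne'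
  have hFc : ContinuousOn (fun x => ∫ u in (0 : ℝ)..x, 1 / ψ u) (Icc 0 a₀) := by
    have := intervalIntegral.continuousOn_primitive_interval'
      (h.intervalIntegrable ⟨h.a₀_pos.le, le_rfl⟩) left_mem_uIcc
    rwa [uIcc_of_le h.a₀_pos.le] at this
  have hd : ∀ s ∈ Ioo 0 ts, HasDerivAt (fun s => (∫ u in (0 : ℝ)..a s, 1 / ψ u) + s) 0 s := by
    intro s hs
    have hm := h.scale_mem hs
    have h1 : HasDerivAt (fun x => ∫ u in (0 : ℝ)..x, 1 / ψ u) (1 / ψ (a s)) (a s) :=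
      intervalIntegral.integral_hasDerivAt_right (h.intervalIntegrable (Ioo_subset_Icc_self hm))
        (hψc.stronglyMeasurableAtFilter isOpen_Ioo _ hm)
        (hψc.continuousAt (isOpen_Ioo.mem_nhds hm))
    have h2 := (h1.comp s (h.hasDerivAt_scale hs)).add (hasDerivAt_id s)
    have h3 : 1 / ψ (a s) * -ψ (a s) + 1 = 0 := by
      have := (h.ψ_pos _ hm).ne'
      field_simp
      norm_num
    rw [h3] at h2
    exact h2
  have hcont : ContinuousOn (fun s => (∫ u in (0 : ℝ)..a s, 1 / ψ u) + s) (Icc 0 t) :=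
    (hFc.comp (h.a_cont.mono fun s hs => ⟨hs.1, hs.2.trans_lt ht.2⟩)
      fun s hs => hmem s ⟨hs.1, hs.2.trans_lt ht.2⟩).add continuousOn_id
  have hconst : (∫ u in (0 : ℝ)..a t, 1 / ψ u) + t = (∫ u in (0 : ℝ)..a 0, 1 / ψ u) + 0 := by
    rcases ht.1.eq_or_lt with h0 | h0
    · rw [← h0]
    · obtain ⟨c, _, hc⟩ := exists_hasDerivAt_eq_slope _ (fun _ => (0 : ℝ)) h0 hcont
        fun s hs => hd s ⟨hs.1, hs.2.trans ht.2⟩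
      rw [eq_div_iff (by linarith), zero_mul] at hc
      exact (sub_eq_zero.mp hc.symm)
  rw [h.a_zero, ← h.ts_eq_intervalIntegral] at hconst
  linarith

lemma tendsto_scale (h : IsCollapsingScalarField a₀ ts ψ a φ V) :
    Tendsto a (𝓝[<] ts) (𝓝[>] 0) := by
  have hev : ∀ᶠ t in 𝓝[<] ts, t ∈ Ioo 0 ts := Ioo_mem_nhdsLT h.ts_pos
  refine tendsto_nhdsWithin_iff.mpr ⟨?_, hev.mono fun t ht => (h.scale_mem ht).1⟩
  refine tendsto_order.mpr ⟨fun e he => hev.mono fun t ht => he.trans (h.scale_mem ht).1,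
    fun e he => ?_⟩
  set e' := min e a₀ with he'
  have hm : e' ∈ Ioc 0 a₀ := ⟨lt_min he h.a₀_pos, min_le_right _ _⟩
  have hF := h.integral_pos hm
  filter_upwards [hev, Ioo_mem_nhdsLT (sub_lt_self ts hF)] with t ht ht'
  by_contra! hcon
  have hle : e' ≤ a t := (min_le_left _ _).trans hcon
  have hi := h.intervalIntegrable (Ioc_subset_Icc_self hm)
  have hi' := h.intervalIntegrable (Ioo_subset_Icc_self (h.scale_mem ht))
  have hsplit := intervalIntegral.integral_add_adjacent_intervals hi (hi.symm.trans hi')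
  have hnn : 0 ≤ ∫ u in e'..a t, 1 / ψ u :=
    intervalIntegral.integral_nonneg hle fun u hu => one_div_nonneg.mpr
      (h.ψ_pos u ⟨hm.1.trans_le hu.1, hu.2.trans_lt (h.scale_mem ht).2⟩).le
  rw [h.integral_scale (Ioo_subset_Ico_self ht)] at hsplit
  linarith [ht'.1]

lemma exists_scale_eq (h : IsCollapsingScalarField a₀ ts ψ a φ V) {x : ℝ} (hx : x ∈ Ioo 0 a₀) :
    ∃ t ∈ Ioo 0 ts, a t = x := by
  have h1 : ∀ᶠ t in 𝓝[<] ts, a t < x :=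
    (tendsto_nhds_of_tendsto_nhdsWithin h.tendsto_scale).eventually_lt_const hx.1
  obtain ⟨t, hlt, ht⟩ := (h1.and (Ioo_mem_nhdsLT h.ts_pos)).exists
  obtain ⟨s, hs, rfl⟩ := intermediate_value_Ioo' ht.1.le
    (h.a_cont.mono fun s hs => ⟨hs.1, hs.2.trans_lt ht.2⟩)
    (show x ∈ Ioo (a t) (a 0) from ⟨hlt, by rw [h.a_zero]; exact hx.2⟩)
  exact ⟨s, ⟨hs.1, hs.2.trans ht.2⟩, rfl⟩

lemma le_one_sub (h : IsCollapsingScalarField a₀ ts ψ a φ V) {rb : ℝ} (hrb : 0 < rb)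
    (haway : ∃ δ > 0, ∀ r ∈ Ioo 0 rb, ∀ t ∈ Ioo 0 ts, δ ≤ |1 - ψ (a t) ^ 2 * r ^ 2|) :
    ∃ δ > 0, ∀ x ∈ Ioo 0 a₀, δ ≤ 1 - ψ x ^ 2 * rb ^ 2 := by
  obtain ⟨δ, hδ, H⟩ := haway
  refine ⟨δ, hδ, fun x hx => ?_⟩
  obtain ⟨t, ht, rfl⟩ := h.exists_scale_eq hx
  exact le_of_forall_le_abs hrb hδ fun r hr => H r hr t ht

lemma tendsto_fieldEnergy (h : IsCollapsingScalarField a₀ ts ψ a φ V) :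
    Tendsto (fieldEnergy φ V) (𝓝[<] ts) atTop := by
  have h1 : Tendsto (fun t => (ψ (a t) / a t) ^ 2) (𝓝[<] ts) atTop :=
    (tendsto_pow_atTop two_ne_zero).comp (h.ψ_div.comp h.tendsto_scale)
  have h2 := h1.const_mul_atTop (show 0 < 3 / (8 * Real.pi) by positivity)
  refine h2.congr' ?_
  filter_upwards [Ioo_mem_nhdsLT h.ts_pos] with t ht
  exact (h.energy_eq t ht).symm

end IsCollapsingScalarField

/-! ### Fundamental forms of spherical shells -/

/-- The spherical shell `(t, θ, ϕ) ↦ (T(t), Y(t), θ, ϕ)`. It covers both sides of the junction, the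
interior one being `T = id` and `Y` constant. -/
def shell (T Y : ℝ → ℝ) (τ : Fin 3 → ℝ) : Fin 4 → ℝ := ![T (τ 0), Y (τ 0), τ 1, τ 2]

lemma pderiv_shell (T Y : ℝ → ℝ) (τ : Fin 3 → ℝ) (α : Fin 3) (k : Fin 4) :
    pderiv α (fun σ => shell T Y σ k) τ =
      !![deriv T (τ 0), deriv Y (τ 0), 0, 0; 0, 0, 1, 0; 0, 0, 0, 1] α k := by
  fin_cases α <;> fin_cases k <;> simp [pderiv, shell]

lemma pderiv_pderiv_shell (T Y : ℝ → ℝ) (τ : Fin 3 → ℝ) (α β : Fin 3) (k : Fin 4) :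
    pderiv α (pderiv β (fun σ => shell T Y σ k)) τ =
      if α = 0 ∧ β = 0 then ![deriv (deriv T) (τ 0), deriv (deriv Y) (τ 0), 0, 0] k else 0 := by
  have : pderiv β (fun σ => shell T Y σ k) = fun τ => _ := funext fun τ => pderiv_shell T Y τ β k
  rw [this]
  fin_cases α <;> fin_cases β <;> fin_cases k <;> simp [pderiv]

/-- No regularity of `T`, `Y` is needed: the coordinate tangent vectors are given by `deriv`
literally. -/
lemma firstForm_shell (d : (Fin 4 → ℝ) → Fin 4 → ℝ) (T Y : ℝ → ℝ) (τ : Fin 3 → ℝ) :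
    firstForm (fun x => Matrix.diagonal (d x)) (shell T Y) τ = Matrix.diagonal
      ![d (shell T Y τ) 0 * deriv T (τ 0) ^ 2 + d (shell T Y τ) 1 * deriv Y (τ 0) ^ 2,
        d (shell T Y τ) 2, d (shell T Y τ) 3] := by
  funext α β
  simp only [firstForm, pderiv_shell, Fin.sum_univ_four]
  fin_cases α <;> fin_cases β <;> simp <;> ring

lemma isOutwardUnitNormal_shell {d : (Fin 4 → ℝ) → Fin 4 → ℝ} {T Y : ℝ → ℝ} {τ : Fin 3 → ℝ}
    (hd : ∀ i, d (shell T Y τ) i ≠ 0) (n : Fin 4 → ℝ) :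
    IsOutwardUnitNormal (fun x => Matrix.diagonal (d x)) (shell T Y) τ n ↔
      n 0 * deriv T (τ 0) + n 1 * deriv Y (τ 0) = 0 ∧ n 2 = 0 ∧ n 3 = 0 ∧
        n 0 ^ 2 / d (shell T Y τ) 0 + n 1 ^ 2 / d (shell T Y τ) 1 = 1 ∧ 0 < n 1 := by
  have hinv : (Matrix.diagonal (d (shell T Y τ)))⁻¹ =
      Matrix.diagonal fun i => (d (shell T Y τ) i)⁻¹ := inv_diagonal hd
  simp only [IsOutwardUnitNormal, hinv, pderiv_shell, Fin.sum_univ_four, Fin.forall_fin_succ]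
  simp
  constructor
  · rintro ⟨⟨h0, h2, h3⟩, h4, h5⟩
    simp only [h2, h3, mul_zero, add_zero] at h4
    refine ⟨h0, h2, h3, ?_, h5⟩
    rw [← h4]; ring
  · rintro ⟨h0, h2, h3, h4, h5⟩
    refine ⟨⟨h0, h2, h3⟩, ?_, h5⟩
    simp only [h2, h3, mul_zero, add_zero]
    rw [← h4]; ring

/-- Diagonal components of the interior metric. -/
noncomputable def interiorComponents (a : ℝ → ℝ) (x : Fin 4 → ℝ) : Fin 4 → ℝ :=
  ![-1, a (x 0) ^ 2, (a (x 0) * x 1) ^ 2, (a (x 0) * x 1 * Real.sin (x 2)) ^ 2]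

lemma interiorComponents_ne_zero {a : ℝ → ℝ} {x : Fin 4 → ℝ} (ha : a (x 0) ≠ 0) (h1 : x 1 ≠ 0)
    (h2 : Real.sin (x 2) ≠ 0) (i : Fin 4) : interiorComponents a x i ≠ 0 := by
  fin_cases i <;> simp [interiorComponents, ha, h1, h2]

/-- Second form of the comoving shell `r = rb` for a radial normal covector; its `tt` component
vanishes because the lines of constant `r`, `θ`, `ϕ` are geodesics. -/
lemma secondForm_interior {a : ℝ → ℝ} {rb : ℝ} {τ : Fin 3 → ℝ} (ha : a (τ 0) ≠ 0) (hrb : rb ≠ 0)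
    (hsin : Real.sin (τ 1) ≠ 0) {n : Fin 4 → ℝ} (h0 : n 0 = 0) (h2 : n 2 = 0) (h3 : n 3 = 0) :
    secondForm (interiorMetric a) (shell id fun _ => rb) τ n =
      Matrix.diagonal ![0, n 1 * rb, n 1 * (rb * Real.sin (τ 1) ^ 2)] := by
  set d := interiorComponents a with hd
  set x : Fin 4 → ℝ := shell id (fun _ => rb) τ with hx
  have x0 : x 0 = τ 0 := rfl
  have x1 : x 1 = rb := rfl
  have x2 : x 2 = τ 1 := rfl
  have hne : ∀ i, d x i ≠ 0 := interiorComponents_ne_zero ha hrb hsin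
  have e0 : pderiv 1 (fun y => d y 0) x = 0 :=
    pderiv_eq_of_hasDerivAt (h := fun _ => -1) (fun s => by simp [hd, interiorComponents])
      (hasDerivAt_const _ _)
  have e2 : pderiv 1 (fun y => d y 2) x = a (τ 0) ^ 2 * (2 * rb) :=
    pderiv_eq_of_hasDerivAt (h := fun s => a (τ 0) ^ 2 * s ^ 2)
      (fun s => by simp [hd, interiorComponents, mul_pow, x0])
      (by rw [x1]; simpa using (hasDerivAt_pow 2 rb).const_mul (a (τ 0) ^ 2))
  have e3 : pderiv 1 (fun y => d y 3) x = a (τ 0) ^ 2 * (2 * rb) * Real.sin (τ 1) ^ 2 :=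
    pderiv_eq_of_hasDerivAt (h := fun s => a (τ 0) ^ 2 * s ^ 2 * Real.sin (τ 1) ^ 2)
      (fun s => by simp [hd, interiorComponents, mul_pow, x0, x2])
      (by rw [x1]; simpa using ((hasDerivAt_pow 2 rb).const_mul (a (τ 0) ^ 2)).mul_const _)
  have hΓ : ∀ k i j, christoffel (interiorMetric a) k i j x = _ := christoffel_diagonal d hne
  funext α β
  simp only [secondForm, ← hx, hΓ, pderiv_shell, pderiv_pderiv_shell, Fin.sum_univ_four, h0, h2, h3]
  fin_cases α <;> fin_cases β <;> simp [e0, e2, e3] <;>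
    simp [hd, interiorComponents, x0] <;> field_simp <;> simp

lemma secondForm_static {f T Y : ℝ → ℝ} {τ : Fin 3 → ℝ} (hd : DifferentiableAt ℝ f (Y (τ 0)))
    (hf : f (Y (τ 0)) ≠ 0) (hY : Y (τ 0) ≠ 0) (hsin : Real.sin (τ 1) ≠ 0)
    {n : Fin 4 → ℝ} (h2 : n 2 = 0) (h3 : n 3 = 0) :
    secondForm (fun x => Matrix.diagonal (staticComponents f x)) (shell T Y) τ n =
      Matrix.diagonal ![-(n 0 * (deriv (deriv T) (τ 0) +
          deriv f (Y (τ 0)) / f (Y (τ 0)) * deriv T (τ 0) * deriv Y (τ 0)) +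
        n 1 * (deriv (deriv Y) (τ 0) + f (Y (τ 0)) * deriv f (Y (τ 0)) / 2 * deriv T (τ 0) ^ 2 -
          deriv f (Y (τ 0)) / (2 * f (Y (τ 0))) * deriv Y (τ 0) ^ 2)),
        n 1 * (f (Y (τ 0)) * Y (τ 0)), n 1 * (f (Y (τ 0)) * Y (τ 0) * Real.sin (τ 1) ^ 2)] := by
  have hΓ : ∀ k i j, christoffel _ k i j (shell T Y τ) = _ :=
    christoffel_static (f := f) (x := shell T Y τ) hd hf hY hsin
  funext α β
  simp only [secondForm, hΓ, pderiv_shell, pderiv_pderiv_shell, Fin.sum_univ_four, h2, h3]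
  fin_cases α <;> fin_cases β <;> simp [staticChristoffel] <;> simp [shell] <;> ring

/-! ### The junction conditions for a shell -/

/-- Equality of the first forms alone fixes the areal radius and normalizes the velocity of the
shell; this is needed before anything is known about the regularity of `f` at the shell. -/
lemma eq_of_firstForm_eq {a f T Y : ℝ → ℝ} {rb : ℝ} {τ : Fin 3 → ℝ} (ha : 0 < a (τ 0))
    (hrb : 0 < rb) (hY : 0 < Y (τ 0))
    (h : firstForm (interiorMetric a) (shell id fun _ => rb) τ =
      firstForm (fun x => Matrix.diagonal (staticComponents f x)) (shell T Y) τ) :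
    Y (τ 0) = a (τ 0) * rb ∧
      -f (Y (τ 0)) * deriv T (τ 0) ^ 2 + (f (Y (τ 0)))⁻¹ * deriv Y (τ 0) ^ 2 = -1 := by
  have hI := firstForm_shell (interiorComponents a) id (fun _ => rb) τ
  have h' := (hI.symm.trans h).trans (firstForm_shell (staticComponents f) T Y τ)
  have h0 := congrFun (congrFun h' 0) 0
  have h1 := congrFun (congrFun h' 1) 1
  simp [shell, interiorComponents, staticComponents, Matrix.diagonal] at h0 h1
  refine ⟨?_, by linarith⟩
  exact ((pow_left_inj₀ (by positivity) hY.le two_ne_zero).mp h1).symm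

/-- The junction conditions determine `f` and the rate of `T` along the shell. -/
lemma eq_of_junction {a f T Y : ℝ → ℝ} {rb : ℝ} {τ : Fin 3 → ℝ} (ha : 0 < a (τ 0))
    (hrb : 0 < rb) (hsin : Real.sin (τ 1) ≠ 0) (hY : 0 < Y (τ 0)) (hT : 0 < deriv T (τ 0))
    (hd : DifferentiableAt ℝ f (Y (τ 0))) {nI nE : Fin 4 → ℝ}
    (h : firstForm (interiorMetric a) (shell id fun _ => rb) τ =
      firstForm (fun x => Matrix.diagonal (staticComponents f x)) (shell T Y) τ)
    (hI : IsOutwardUnitNormal (interiorMetric a) (shell id fun _ => rb) τ nI)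
    (hE : IsOutwardUnitNormal (fun x => Matrix.diagonal (staticComponents f x)) (shell T Y) τ nE)
    (hII : secondForm (interiorMetric a) (shell id fun _ => rb) τ nI =
      secondForm (fun x => Matrix.diagonal (staticComponents f x)) (shell T Y) τ nE) :
    f (Y (τ 0)) = 1 - deriv Y (τ 0) ^ 2 ∧ deriv T (τ 0) = (f (Y (τ 0)))⁻¹ := by
  obtain ⟨hYa, h1⟩ := eq_of_firstForm_eq ha hrb hY h
  -- If `f = 0`, the exterior `tt` component of the first form is `0`, since `0⁻¹ = 0`.
  have hf : f (Y (τ 0)) ≠ 0 := by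
    intro h0
    rw [h0] at h1
    norm_num at h1
  have hI' := (isOutwardUnitNormal_shell (d := interiorComponents a)
    (interiorComponents_ne_zero (x := shell id (fun _ => rb) τ) ha.ne' hrb.ne' hsin) nI).mp hI
  have hE' := (isOutwardUnitNormal_shell
    (staticComponents_ne_zero (x := shell T Y τ) hf hY.ne' hsin) nE).mp hE
  obtain ⟨i0, i2, i3, iu, ip⟩ := hI'
  obtain ⟨e0, e2, e3, eu, ep⟩ := hE'
  simp [shell, interiorComponents] at i0 iu
  simp [shell, staticComponents] at eu
  have hn : nI 1 = a (τ 0) := by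
    rw [i0] at iu
    have : nI 1 ^ 2 = a (τ 0) ^ 2 := by
      field_simp at iu
      linarith
    exact (pow_left_inj₀ ip.le ha.le two_ne_zero).mp this
  -- The `θθ` components of the second forms read `a rb = n_Y f Y`.
  have h11 := congrFun (congrFun hII 1) 1
  rw [secondForm_interior ha.ne' hrb.ne' hsin i0 i2 i3,
    secondForm_static hd hf hY.ne' hsin e2 e3] at h11
  simp [Matrix.diagonal] at h11
  rw [hn, ← hYa] at h11
  have hnE : nE 1 * f (Y (τ 0)) = 1 := by
    have : (nE 1 * f (Y (τ 0)) - 1) * Y (τ 0) = 0 := by linarith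
    rcases mul_eq_zero.mp this with h | h
    · linarith
    · exact absurd h hY.ne'
  set X := f (Y (τ 0)) with hX
  set T' := deriv T (τ 0)
  set Y' := deriv Y (τ 0)
  have hXpos : 0 < X := pos_of_mul_pos_right (by rw [hnE]; exact one_pos) ep.le
  have hn1 : nE 1 = X⁻¹ := eq_inv_of_mul_eq_one_left hnE
  have hn0 : nE 0 ^ 2 = 1 - X := by
    rw [hn1] at eu
    field_simp at eu
    linarith
  have hT2 : X ^ 2 * T' ^ 2 = X + Y' ^ 2 := by
    field_simp at h1
    linarith
  have hsq : (1 - X) * (X + Y' ^ 2) = Y' ^ 2 := by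
    have h5 : nE 0 * T' = -(X⁻¹ * Y') := by rw [← hn1]; linarith
    have h6 : nE 0 ^ 2 * T' ^ 2 = X⁻¹ ^ 2 * Y' ^ 2 := by rw [← mul_pow, h5]; ring
    rw [← hT2, ← hn0]
    calc nE 0 ^ 2 * (X ^ 2 * T' ^ 2) = X ^ 2 * (nE 0 ^ 2 * T' ^ 2) := by ring
      _ = Y' ^ 2 := by rw [h6]; field_simp
  have hres : X = 1 - Y' ^ 2 := by
    have : X * (1 - X - Y' ^ 2) = 0 := by linarith
    rcases mul_eq_zero.mp this with h | h
    · exact absurd h hf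
    · linarith
  refine ⟨hres, ?_⟩
  have h7 : (X * T') ^ 2 = 1 ^ 2 := by rw [mul_pow, hT2]; linarith
  have h8 := (pow_left_inj₀ (by positivity) zero_le_one two_ne_zero).mp h7
  exact eq_inv_of_mul_eq_one_right h8

/-- Converse of `eq_of_junction`: the unit normals are the radial one in the interior and
`-Ẏ dT + Ṫ dY` in the exterior. -/
lemma junction_of_eq {a f T Y : ℝ → ℝ} {rb : ℝ} {τ : Fin 3 → ℝ} (ha : 0 < a (τ 0))
    (hrb : 0 < rb) (hsin : Real.sin (τ 1) ≠ 0) (hf : 0 < f (Y (τ 0)))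
    (hd : DifferentiableAt ℝ f (Y (τ 0))) (hYa : Y (τ 0) = a (τ 0) * rb)
    (hY1 : deriv Y (τ 0) ^ 2 = 1 - f (Y (τ 0)))
    (hY2 : deriv (deriv Y) (τ 0) = -deriv f (Y (τ 0)) / 2)
    (hT1 : deriv T (τ 0) = (f (Y (τ 0)))⁻¹)
    (hT2 : deriv (deriv T) (τ 0) = -(deriv f (Y (τ 0)) * deriv Y (τ 0)) / f (Y (τ 0)) ^ 2) :
    firstForm (interiorMetric a) (shell id fun _ => rb) τ =
      firstForm (fun x => Matrix.diagonal (staticComponents f x)) (shell T Y) τ ∧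
    ∃ nI nE, IsOutwardUnitNormal (interiorMetric a) (shell id fun _ => rb) τ nI ∧
      IsOutwardUnitNormal (fun x => Matrix.diagonal (staticComponents f x)) (shell T Y) τ nE ∧
      secondForm (interiorMetric a) (shell id fun _ => rb) τ nI =
        secondForm (fun x => Matrix.diagonal (staticComponents f x)) (shell T Y) τ nE := by
  have hY : 0 < Y (τ 0) := by rw [hYa]; positivity
  refine ⟨?_, ![0, a (τ 0), 0, 0], ![-deriv Y (τ 0), deriv T (τ 0), 0, 0], ?_, ?_, ?_⟩
  · have hI := firstForm_shell (interiorComponents a) id (fun _ => rb) τ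
    refine hI.trans (Eq.trans ?_ (firstForm_shell (staticComponents f) T Y τ).symm)
    congr 1
    funext i
    fin_cases i
    · simp [shell, interiorComponents, staticComponents, hT1, hY1]
      field_simp
      ring
    · simp [shell, interiorComponents, staticComponents, hYa]
    · simp [shell, interiorComponents, staticComponents, hYa]
  · refine (isOutwardUnitNormal_shell (d := interiorComponents a)
      (interiorComponents_ne_zero (x := shell id (fun _ => rb) τ) ha.ne' hrb.ne' hsin) _).mpr ?_
    simp [shell, interiorComponents, ha, ha.ne']
  · refine (isOutwardUnitNormal_shell
      (staticComponents_ne_zero (x := shell T Y τ) hf.ne' hY.ne' hsin) _).mpr ?_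
    refine ⟨?_, rfl, rfl, ?_, ?_⟩
    · simp; ring
    · simp [shell, staticComponents, hT1, hY1]
      field_simp
      ring
    · simpa [hT1] using hf
  · rw [secondForm_interior ha.ne' hrb.ne' hsin rfl rfl rfl,
      secondForm_static hd hf.ne' hY.ne' hsin rfl rfl]
    congr 1
    funext i
    fin_cases i
    · simp [hT1, hY2, hT2]
      field_simp
      rw [hY1]
      ring
    · simp [hT1]
      field_simp
      linarith
    · simp [hT1]
      field_simp
      rw [hYa]

/-! ### Primitives of bounded functions -/

lemma intervalIntegrable_of_continuousOn_of_le {g : ℝ → ℝ} {b K : ℝ} (hg : ContinuousOn g (Ioo 0 b))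
    (hK : ∀ x ∈ Ioo 0 b, |g x| ≤ K) {x : ℝ} (hx : x ∈ Icc 0 b) :
    IntervalIntegrable g MeasureTheory.volume 0 x := by
  rw [intervalIntegrable_iff_integrableOn_Ioo_of_le hx.1]
  refine MeasureTheory.IntegrableOn.mono_set ?_ (Ioo_subset_Ioo_right hx.2)
  refine MeasureTheory.Integrable.of_bound (hg.aestronglyMeasurable measurableSet_Ioo) K ?_
  filter_upwards [MeasureTheory.ae_restrict_mem measurableSet_Ioo] with x hx using hK x hx

lemma hasDerivAt_integral {g : ℝ → ℝ} {b K : ℝ} (hg : ContinuousOn g (Ioo 0 b))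
    (hK : ∀ x ∈ Ioo 0 b, |g x| ≤ K) {x : ℝ} (hx : x ∈ Ioo 0 b) :
    HasDerivAt (fun s => ∫ u in (0 : ℝ)..s, g u) (g x) x :=
  intervalIntegral.integral_hasDerivAt_right
    (intervalIntegrable_of_continuousOn_of_le hg hK (Ioo_subset_Icc_self hx))
    (hg.stronglyMeasurableAtFilter isOpen_Ioo _ hx) (hg.continuousAt (isOpen_Ioo.mem_nhds hx))

lemma tendsto_integral_zero {g : ℝ → ℝ} {b K : ℝ} (hb : 0 < b) (hg : ContinuousOn g (Ioo 0 b))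
    (hK : ∀ x ∈ Ioo 0 b, |g x| ≤ K) :
    Tendsto (fun s => ∫ u in (0 : ℝ)..s, g u) (𝓝[>] 0) (𝓝 0) := by
  have h := intervalIntegral.continuousOn_primitive_interval'
    (intervalIntegrable_of_continuousOn_of_le hg hK ⟨hb.le, le_rfl⟩) left_mem_uIcc
  rw [uIcc_of_le hb.le] at h
  have h0 := (h 0 ⟨le_rfl, hb.le⟩).tendsto
  rw [intervalIntegral.integral_same] at h0
  exact h0.mono_left (nhdsWithin_le_of_mem (mem_of_superset (Ioo_mem_nhdsGT hb)
    Ioo_subset_Icc_self))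

lemma exists_tendsto_of_deriv_bounded {T : ℝ → ℝ} {b K : ℝ}
    (hT : DifferentiableOn ℝ T (Ioo 0 b)) (hb : 0 < b) (hK : ∀ t ∈ Ioo 0 b, |deriv T t| ≤ K) :
    ∃ T₀, Tendsto T (𝓝[<] b) (𝓝 T₀) := by
  have hL : LipschitzOnWith K.toNNReal T (Ioo 0 b) := by
    refine (convex_Ioo 0 b).lipschitzOnWith_of_nnnorm_deriv_le
      (fun t ht => hT.differentiableAt (isOpen_Ioo.mem_nhds ht)) fun t ht => ?_
    rw [← NNReal.coe_le_coe, coe_nnnorm, Real.norm_eq_abs]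
    exact (hK t ht).trans (Real.le_coe_toNNReal K)
  obtain ⟨g, hg, hEq⟩ := hL.extend_real
  refine ⟨g b, ((hg.continuous.tendsto b).mono_left nhdsWithin_le_nhds).congr' ?_⟩
  filter_upwards [Ioo_mem_nhdsLT hb] with t ht using (hEq ht).symm

/-! ### Matched exteriors -/

lemma contDiffOn_chi {M : ℝ → ℝ} {b : ℝ} (hM : ContDiffOn ℝ ∞ M (Ioo 0 b)) :
    ContDiffOn ℝ ∞ (chi M) (Ioo 0 b) :=
  contDiffOn_const.sub ((contDiffOn_const.mul hM).div contDiffOn_id fun _ hx => hx.1.ne')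

lemma differentiableAt_deriv_of_contDiffOn {f : ℝ → ℝ} {b x : ℝ} (hf : ContDiffOn ℝ ∞ f (Ioo 0 b))
    (hx : x ∈ Ioo 0 b) : DifferentiableAt ℝ (deriv f) x :=
  (((contDiffOn_infty_iff_deriv_of_isOpen isOpen_Ioo).mp hf).2.differentiableOn
    (by simp)).differentiableAt (isOpen_Ioo.mem_nhds hx)

lemma contDiffOn_differentiableAt {f : ℝ → ℝ} {b x : ℝ} (hf : ContDiffOn ℝ ∞ f (Ioo 0 b))
    (hx : x ∈ Ioo 0 b) : DifferentiableAt ℝ f x :=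
  (hf.differentiableOn (by simp)).differentiableAt (isOpen_Ioo.mem_nhds hx)

lemma div_mem_Ioo {a₀ rb y : ℝ} (hrb : 0 < rb) (hy : y ∈ Ioo 0 (a₀ * rb)) :
    y / rb ∈ Ioo 0 a₀ := ⟨div_pos hy.1 hrb, (div_lt_iff₀ hrb).mpr hy.2⟩

namespace IsCollapsingScalarField

variable {a₀ ts rb : ℝ} {ψ a φ V : ℝ → ℝ}

lemma hasDerivAt_profile (h : IsCollapsingScalarField a₀ ts ψ a φ V) {x : ℝ} (hx : x ∈ Ioo 0 a₀) :
    HasDerivAt ψ (deriv ψ x) x :=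
  (contDiffOn_differentiableAt h.ψ_smooth hx).hasDerivAt

lemma mul_mem (h : IsCollapsingScalarField a₀ ts ψ a φ V) (hrb : 0 < rb) {t : ℝ}
    (ht : t ∈ Ioo 0 ts) : a t * rb ∈ Ioo 0 (a₀ * rb) :=
  ⟨mul_pos (h.scale_mem ht).1 hrb, mul_lt_mul_of_pos_right (h.scale_mem ht).2 hrb⟩

/-- Bootstrapping `ȧ = -ψ(a)` from differentiability of `a`. -/
lemma contDiffOn_scale (h : IsCollapsingScalarField a₀ ts ψ a φ V) :
    ContDiffOn ℝ 2 a (Ioo 0 ts) := by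
  have hmaps : MapsTo a (Ioo 0 ts) (Ioo 0 a₀) := fun t ht => h.scale_mem ht
  have hdiff : DifferentiableOn ℝ a (Ioo 0 ts) := fun t ht =>
    (h.a_diff t ht).differentiableWithinAt
  have step : ∀ n : ℕ, ContDiffOn ℝ n a (Ioo 0 ts) → ContDiffOn ℝ (n + 1) a (Ioo 0 ts) := by
    intro n hn
    refine (contDiffOn_succ_iff_deriv_of_isOpen isOpen_Ioo).mpr ⟨hdiff, by simp, ?_⟩
    refine ((h.ψ_smooth.of_le (mod_cast le_top)).comp hn hmaps).neg.congr fun t ht => ?_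
    exact (h.hasDerivAt_scale ht).deriv
  have h0 : ContDiffOn ℝ ((0 : ℕ) : WithTop ℕ∞) a (Ioo 0 ts) := by
    simpa using hdiff.continuousOn
  have h1 := step 1 (by simpa using step 0 h0)
  norm_num at h1
  exact h1

/-- Here `f` is known only on `(0, a₀ rb)`, so that the lemma applies to `chi M` for any
matched `M`. -/
lemma hasDerivAt_chi (h : IsCollapsingScalarField a₀ ts ψ a φ V) (hrb : 0 < rb) {f : ℝ → ℝ}
    (hf : ∀ y ∈ Ioo 0 (a₀ * rb), f y = 1 - ψ (y / rb) ^ 2 * rb ^ 2) {y : ℝ}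
    (hy : y ∈ Ioo 0 (a₀ * rb)) :
    HasDerivAt f (-(2 * ψ (y / rb) * deriv ψ (y / rb) * rb)) y := by
  have h1 := (h.hasDerivAt_profile (div_mem_Ioo hrb hy)).comp y ((hasDerivAt_id y).div_const rb)
  have h2 := ((h1.pow 2).mul_const (rb ^ 2)).const_sub 1
  refine (h2.congr_of_eventuallyEq ?_).congr_deriv ?_
  · filter_upwards [isOpen_Ioo.mem_nhds hy] with z hz using hf z hz
  · simp
    field_simp

lemma exists_isMatched (h : IsCollapsingScalarField a₀ ts ψ a φ V) (hrb : 0 < rb)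
    {δ : ℝ} (hδ : 0 < δ) (hle : ∀ x ∈ Ioo 0 a₀, δ ≤ 1 - ψ x ^ 2 * rb ^ 2) :
    ∃ M T Y : ℝ → ℝ, IsMatched a₀ ts rb a M T Y := by
  -- The mass function with `χ(y) = 1 - ψ(y / rb)² rb²`, and the primitive of `1 / χ` along the
  -- shell.
  set M : ℝ → ℝ := fun y => y / 2 * (ψ (y / rb) ^ 2 * rb ^ 2) with hM
  set Y : ℝ → ℝ := fun t => a t * rb with hYdef
  set q : ℝ → ℝ := fun t => (1 - ψ (a t) ^ 2 * rb ^ 2)⁻¹ with hq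
  set T : ℝ → ℝ := fun t => ∫ s in (0 : ℝ)..t, q s with hTdef
  have hmaps : MapsTo a (Ioo 0 ts) (Ioo 0 a₀) := fun t ht => h.scale_mem ht
  have hpos : ∀ t ∈ Ioo 0 ts, 0 < 1 - ψ (a t) ^ 2 * rb ^ 2 := fun t ht =>
    hδ.trans_le (hle _ (hmaps ht))
  have hM' : ContDiffOn ℝ ∞ M (Ioo 0 (a₀ * rb)) := by
    have : ContDiffOn ℝ ∞ (fun y => ψ (y / rb)) (Ioo 0 (a₀ * rb)) :=
      h.ψ_smooth.comp (contDiffOn_id.div_const rb) fun y hy => div_mem_Ioo hrb hy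
    exact (contDiffOn_id.div_const 2).mul ((this.pow 2).mul contDiffOn_const)
  have hchi : ∀ y ∈ Ioo 0 (a₀ * rb), chi M y = 1 - ψ (y / rb) ^ 2 * rb ^ 2 := by
    intro y hy
    have := hy.1.ne'
    simp only [chi, hM]
    field_simp
  have hchiY : ∀ t ∈ Ioo 0 ts, chi M (Y t) = 1 - ψ (a t) ^ 2 * rb ^ 2 := by
    intro t ht
    rw [hchi _ (h.mul_mem hrb ht), mul_div_cancel_right₀ _ hrb.ne']
  have hψa : ContDiffOn ℝ 1 (fun t => ψ (a t)) (Ioo 0 ts) :=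
    (h.ψ_smooth.of_le (mod_cast le_top)).comp (h.contDiffOn_scale.of_le (by norm_num)) hmaps
  have hqc : ContDiffOn ℝ 1 q (Ioo 0 ts) :=
    (contDiffOn_const.sub ((hψa.pow 2).mul contDiffOn_const)).inv fun t ht => (hpos t ht).ne'
  have hT1 : ∀ t ∈ Ioo 0 ts, HasDerivAt T (q t) t := fun t ht =>
    hasDerivAt_integral hqc.continuousOn (K := δ⁻¹) (fun s hs => by
      rw [abs_of_pos (inv_pos.mpr (hpos s hs))]
      exact inv_anti₀ hδ (hle _ (hmaps hs))) ht
  have hY1 : ∀ t ∈ Ioo 0 ts, HasDerivAt Y (-ψ (a t) * rb) t := fun t ht =>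
    (h.hasDerivAt_scale ht).mul_const rb
  refine ⟨M, T, Y, hM', ?_, h.contDiffOn_scale.mul contDiffOn_const,
    fun t ht => (h.mul_mem hrb ht).1, fun t ht => ?_, ?_⟩
  · have : ContDiffOn ℝ (1 + 1) T (Ioo 0 ts) := by
      refine (contDiffOn_succ_iff_deriv_of_isOpen isOpen_Ioo).mpr
        ⟨fun t ht => (hT1 t ht).differentiableAt.differentiableWithinAt, by simp, ?_⟩
      exact hqc.congr fun t ht => (hT1 t ht).deriv
    norm_num at this
    exact this
  · rw [(hT1 t ht).deriv]
    exact inv_pos.mpr (hpos t ht)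
  · rintro τ ⟨ht, hθ⟩
    have hnhds := isOpen_Ioo.mem_nhds ht
    have hc := h.hasDerivAt_chi hrb hchi (h.mul_mem hrb ht)
    rw [mul_div_cancel_right₀ _ hrb.ne'] at hc
    -- These two values are `Ÿ = -χ' / 2` and `T̈ = -χ' Ẏ / χ²`.
    have hy2 : HasDerivAt (deriv Y) (deriv ψ (a (τ 0)) * ψ (a (τ 0)) * rb) (τ 0) := by
      have h1 := (((h.hasDerivAt_profile (hmaps ht)).comp (τ 0)
        (h.hasDerivAt_scale ht)).neg.mul_const rb)
      refine (h1.congr_of_eventuallyEq ?_).congr_deriv (by ring)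
      filter_upwards [hnhds] with s hs using (hY1 s hs).deriv
    have ht2 : HasDerivAt (deriv T) (-(deriv (chi M) (Y (τ 0)) * deriv Y (τ 0)) /
        chi M (Y (τ 0)) ^ 2) (τ 0) := by
      have h0 : chi M (Y (τ 0)) ≠ 0 := by rw [hchiY _ ht]; exact (hpos _ ht).ne'
      have h1 : HasDerivAt (fun s => chi M (Y s)) _ (τ 0) :=
        HasDerivAt.comp (h₂ := chi M) (τ 0) hc.differentiableAt.hasDerivAt
          (hY1 _ ht).differentiableAt.hasDerivAt
      refine (h1.inv h0).congr_of_eventuallyEq ?_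
      filter_upwards [hnhds] with s hs
      rw [(hT1 s hs).deriv, Pi.inv_apply, hchiY s hs]
    refine junction_of_eq (f := chi M) (h.scale_mem ht).1 hrb (Real.sin_pos_of_mem_Ioo hθ).ne' ?_
      hc.differentiableAt rfl ?_ ?_ ?_ ht2.deriv
    · rw [hchiY _ ht]; exact hpos _ ht
    · rw [(hY1 _ ht).deriv, hchiY _ ht]; ring
    · rw [hy2.deriv, hc.deriv]; ring
    · rw [(hT1 _ ht).deriv, hchiY _ ht]

end IsCollapsingScalarField

namespace IsMatched

variable {a₀ ts rb : ℝ} {ψ a φ V M T Y : ℝ → ℝ}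

lemma areal_radius_eq (hm : IsMatched a₀ ts rb a M T Y) (hrb : 0 < rb)
    (h : IsCollapsingScalarField a₀ ts ψ a φ V) {t : ℝ} (ht : t ∈ Ioo 0 ts) :
    Y t = a t * rb :=
  (eq_of_firstForm_eq (f := chi M) (τ := ![t, Real.pi / 2, 0]) (h.scale_mem ht).1 hrb
    (hm.Y_pos t ht) (hm.junction ![t, Real.pi / 2, 0]
      ⟨ht, by simp [Real.pi_pos], by simp [Real.pi_pos]⟩).1).1

/-- Along the shell, `χ = 1 - Ẏ²` with `Ẏ = -ψ(a) rb`. -/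
lemma chi_comp_eq (hm : IsMatched a₀ ts rb a M T Y) (hrb : 0 < rb)
    (h : IsCollapsingScalarField a₀ ts ψ a φ V) {t : ℝ} (ht : t ∈ Ioo 0 ts) :
    chi M (Y t) = 1 - ψ (a t) ^ 2 * rb ^ 2 ∧ deriv T t = (chi M (Y t))⁻¹ := by
  have hθ : Real.pi / 2 ∈ Ioo 0 Real.pi := ⟨by linarith [Real.pi_pos], by linarith [Real.pi_pos]⟩
  obtain ⟨h1, nI, nE, hI, hE, hII⟩ := hm.junction ![t, Real.pi / 2, 0] ⟨ht, hθ⟩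
  have hd : DifferentiableAt ℝ (chi M) (Y t) :=
    contDiffOn_differentiableAt (contDiffOn_chi hm.M_smooth)
      (hm.areal_radius_eq hrb h ht ▸ h.mul_mem hrb ht)
  have hY : HasDerivAt Y (-ψ (a t) * rb) t := by
    refine ((h.hasDerivAt_scale ht).mul_const rb).congr_of_eventuallyEq ?_
    filter_upwards [isOpen_Ioo.mem_nhds ht] with s hs using hm.areal_radius_eq hrb h hs
  obtain ⟨e1, e2⟩ := eq_of_junction (f := chi M) (τ := ![t, Real.pi / 2, 0]) (h.scale_mem ht).1 hrb
    (Real.sin_pos_of_mem_Ioo hθ).ne' (hm.Y_pos t ht) (hm.T_future t ht) hd h1 hI hE hII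
  refine ⟨?_, e2⟩
  have e1' : chi M (Y t) = 1 - deriv Y t ^ 2 := e1
  rw [e1', hY.deriv]
  ring

/-- The shell sweeps out all radii below `a₀ rb`, so its history determines `χ` there. -/
lemma chi_eq (hm : IsMatched a₀ ts rb a M T Y) (hrb : 0 < rb)
    (h : IsCollapsingScalarField a₀ ts ψ a φ V) {y : ℝ} (hy : y ∈ Ioo 0 (a₀ * rb)) :
    chi M y = 1 - ψ (y / rb) ^ 2 * rb ^ 2 := by
  obtain ⟨t, ht, hty⟩ := h.exists_scale_eq (div_mem_Ioo hrb hy)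
  have := (hm.chi_comp_eq hrb h ht).1
  rwa [hm.areal_radius_eq hrb h ht, hty, div_mul_cancel₀ _ hrb.ne'] at this

lemma tendsto_energyDensity (hm : IsMatched a₀ ts rb a M T Y) (hrb : 0 < rb)
    (h : IsCollapsingScalarField a₀ ts ψ a φ V)
    (hpos : ∀ y ∈ Ioo 0 (a₀ * rb), 0 < chi M y)
    (hp : Tendsto (pressure ψ) (𝓝[>] 0) atBot) (T₁ : ℝ) {θ : ℝ} (hθ : θ ∈ Ioo 0 Real.pi) (ϕ : ℝ) :
    Tendsto (fun y => energyDensity (exteriorMetric M) ![T₁, y, θ, ϕ]) (𝓝[>] 0) atTop := by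
  have hdiv : Tendsto (fun y : ℝ => y / rb) (𝓝[>] 0) (𝓝[>] 0) := by
    refine tendsto_nhdsWithin_iff.mpr ⟨?_, ?_⟩
    · have : Tendsto (fun y : ℝ => y / rb) (𝓝 0) (𝓝 (0 / rb)) := tendsto_id.div_const rb
      rw [zero_div] at this
      exact this.mono_left nhdsWithin_le_nhds
    · filter_upwards [self_mem_nhdsWithin] with y hy using div_pos hy hrb
  refine (tendsto_neg_atBot_atTop.comp (hp.comp hdiv)).congr' ?_
  filter_upwards [Ioo_mem_nhdsGT (mul_pos h.a₀_pos hrb)] with y hy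
  have hC := contDiffOn_chi hm.M_smooth
  have hev : ∀ᶠ z in 𝓝 y, DifferentiableAt ℝ (chi M) z := by
    filter_upwards [isOpen_Ioo.mem_nhds hy] with z hz using contDiffOn_differentiableAt hC hz
  have hE : energyDensity (exteriorMetric M) ![T₁, y, θ, ϕ] =
      (1 - chi M y - y * deriv (chi M) y) / (8 * Real.pi * y ^ 2) :=
    energyDensity_static (f := chi M) (x := ![T₁, y, θ, ϕ]) hev
      (differentiableAt_deriv_of_contDiffOn hC hy) (hpos y hy).ne' hy.1.ne'
      (Real.sin_pos_of_mem_Ioo hθ).ne'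
  rw [hE, (h.hasDerivAt_chi hrb (fun z hz => hm.chi_eq hrb h hz) hy).deriv, hm.chi_eq hrb h hy]
  have hψ := (h.ψ_pos _ (div_mem_Ioo hrb hy)).ne'
  have hy0 := hy.1.ne'
  have hpi := Real.pi_ne_zero
  simp only [Function.comp, pressure]
  generalize ψ (y / rb) = p at *
  generalize deriv ψ (y / rb) = p' at *
  field_simp
  ring

end IsMatched

/-! ### The outgoing null geodesic and the collapse -/

/-- Staticity makes `χ Ṫ` constant along radial null geodesics, so the areal radius `Y = s` is an
affine parameter and `T` is a primitive of `1 / χ`. -/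
lemma isRadialNullGeodesicFrom {M T Y : ℝ → ℝ} {ts S δ : ℝ} (hS : 0 < S)
    (hM : ContDiffOn ℝ ∞ (chi M) (Ioo 0 S)) (hδ : 0 < δ) (hle : ∀ y ∈ Ioo 0 S, δ ≤ chi M y)
    (T₀ : ℝ) {θ₀ : ℝ} (hθ : θ₀ ∈ Ioo 0 Real.pi) (ϕ₀ : ℝ) :
    IsRadialNullGeodesicFrom (exteriorMetric M) (exteriorRegion ts S T₀ M T Y) T₀ θ₀ ϕ₀ S
      (fun s => ![T₀ + ∫ y in (0 : ℝ)..s, (chi M y)⁻¹, s, θ₀, ϕ₀]) := by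
  have hpos : ∀ y ∈ Ioo 0 S, 0 < chi M y := fun y hy => hδ.trans_le (hle y hy)
  have hc : ContinuousOn (fun y => (chi M y)⁻¹) (Ioo 0 S) :=
    hM.continuousOn.inv₀ fun y hy => (hpos y hy).ne'
  have hK : ∀ y ∈ Ioo 0 S, |(chi M y)⁻¹| ≤ δ⁻¹ := fun y hy => by
    rw [abs_of_pos (inv_pos.mpr (hpos y hy))]
    exact inv_anti₀ hδ (hle y hy)
  set γ : ℝ → Fin 4 → ℝ := fun s => ![T₀ + ∫ y in (0 : ℝ)..s, (chi M y)⁻¹, s, θ₀, ϕ₀] with hγ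
  have hγ' : ∀ s ∈ Ioo 0 S, HasDerivAt γ ![(chi M s)⁻¹, 1, 0, 0] s := by
    intro s hs
    refine hasDerivAt_pi.mpr fun i => ?_
    fin_cases i
    · exact (hasDerivAt_integral hc hK hs).const_add T₀
    · exact hasDerivAt_id s
    · exact hasDerivAt_const s θ₀
    · exact hasDerivAt_const s ϕ₀
  have hsin := (Real.sin_pos_of_mem_Ioo hθ).ne'
  refine ⟨fun s hs => ⟨(hγ' s hs).differentiableAt, fun k => ?_⟩, fun s hs => ?_,
    fun s hs => ⟨rfl, rfl⟩, fun s hs => ?_, fun s hs => ?_, fun s hs => ?_, ?_⟩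
  · have hd := contDiffOn_differentiableAt hM hs
    have hne := (hpos s hs).ne'
    have hev : (fun u => deriv γ u k) =ᶠ[𝓝 s]
        fun u => (![(chi M u)⁻¹, 1, 0, 0] : Fin 4 → ℝ) k := by
      filter_upwards [isOpen_Ioo.mem_nhds hs] with u hu
      rw [(hγ' u hu).deriv]
    have hΓ : ∀ k i j, christoffel (exteriorMetric M) k i j (γ s) = _ :=
      christoffel_static (f := chi M) (x := γ s) hd hne hs.1.ne' hsin
    refine HasDerivAt.congr_of_eventuallyEq ?_ hev
    simp only [hΓ, (hγ' s hs).deriv, Fin.sum_univ_four]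
    fin_cases k
    · refine (hd.hasDerivAt.inv hne).congr_deriv ?_
      simp [staticChristoffel, hγ]
      field_simp
      ring
    · refine (hasDerivAt_const s 1).congr_deriv ?_
      simp [staticChristoffel, hγ]
      field_simp
      ring
    · refine (hasDerivAt_const s 0).congr_deriv ?_
      simp [staticChristoffel]
    · refine (hasDerivAt_const s 0).congr_deriv ?_
      simp [staticChristoffel]
  · have hne := (hpos s hs).ne'
    rw [(hγ' s hs).deriv]
    simp [Fin.sum_univ_four, exteriorMetric, hγ]
    field_simp
    ring
  · rw [(hγ' s hs).deriv]
    exact inv_pos.mpr (hpos s hs)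
  · rw [(hγ' s hs).deriv]
    exact one_pos
  · refine ⟨hs, hθ, hpos s hs, Or.inl ?_⟩
    have : 0 ≤ ∫ y in (0 : ℝ)..s, (chi M y)⁻¹ := by
      rw [intervalIntegral.integral_of_le hs.1.le, MeasureTheory.integral_Ioc_eq_integral_Ioo]
      exact MeasureTheory.setIntegral_nonneg measurableSet_Ioo fun y hy =>
        (inv_pos.mpr (hpos y ⟨hy.1, hy.2.trans hs.2⟩)).le
    simpa [hγ] using this
  · refine tendsto_pi_nhds.mpr fun i => ?_
    fin_cases i
    · simpa [hγ] using (tendsto_integral_zero hS hc hK).const_add T₀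
    · exact tendsto_nhdsWithin_of_tendsto_nhds tendsto_id
    · simp [hγ]
    · simp [hγ]

lemma IsMatched.collapsesToNakedSingularity {a₀ ts rb δ : ℝ} {ψ a φ V M T Y : ℝ → ℝ}
    (hm : IsMatched a₀ ts rb a M T Y) (hrb : 0 < rb)
    (h : IsCollapsingScalarField a₀ ts ψ a φ V)
    (hp : Tendsto (pressure ψ) (𝓝[>] 0) atBot)
    (hδ : 0 < δ) (hle : ∀ x ∈ Ioo 0 a₀, δ ≤ 1 - ψ x ^ 2 * rb ^ 2) :
    CollapsesToNakedSingularity a₀ ts rb φ V M T Y := by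
  have hS : 0 < a₀ * rb := mul_pos h.a₀_pos hrb
  have hchi : ∀ y ∈ Ioo 0 (a₀ * rb), δ ≤ chi M y := fun y hy => by
    rw [hm.chi_eq hrb h hy]
    exact hle _ (div_mem_Ioo hrb hy)
  obtain ⟨T₀, hT₀⟩ : ∃ T₀, Tendsto T (𝓝[<] ts) (𝓝 T₀) := by
    refine exists_tendsto_of_deriv_bounded (hm.T_smooth.differentiableOn (by simp)) h.ts_pos
      (K := δ⁻¹) fun t ht => ?_
    rw [abs_of_pos (hm.T_future t ht), (hm.chi_comp_eq hrb h ht).2]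
    exact inv_anti₀ hδ (hchi _ (hm.areal_radius_eq hrb h ht ▸ h.mul_mem hrb ht))
  refine ⟨T₀, hT₀, ?_, h.tendsto_fieldEnergy, fun T₁ θ hθ ϕ => hm.tendsto_energyDensity hrb h
    (fun y hy => hδ.trans_le (hchi y hy)) hp T₁ hθ ϕ, fun θ₀ hθ ϕ₀ => ⟨a₀ * rb, hS, _,
    isRadialNullGeodesicFrom hS (contDiffOn_chi hm.M_smooth) hδ hchi T₀ hθ ϕ₀⟩⟩
  have h1 : Tendsto (fun t => a t * rb) (𝓝[<] ts) (𝓝 (0 * rb)) :=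
    (tendsto_nhds_of_tendsto_nhdsWithin h.tendsto_scale).mul_const rb
  rw [zero_mul] at h1
  refine h1.congr' ?_
  filter_upwards [Ioo_mem_nhdsLT h.ts_pos] with t ht using (hm.areal_radius_eq hrb h ht).symm

end ScalarCollapse

theorem theorem5p1 (a₀ ts rb : ℝ) (ψ a φ V : ℝ → ℝ)
    (hfield : ScalarCollapse.IsCollapsingScalarField a₀ ts ψ a φ V)
    (hbounded : ∃ C : ℝ, ∀ x ∈ Set.Ioo 0 a₀, |ψ x| ≤ C)
    (hpressure : Filter.Tendsto (ScalarCollapse.pressure ψ) (nhdsWithin 0 (Set.Ioi 0)) Filter.atBot)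
    (hrb : 0 < rb)
    (haway : ∃ δ > 0, ∀ r ∈ Set.Ioo 0 rb, ∀ t ∈ Set.Ioo 0 ts, δ ≤ |1 - ψ (a t) ^ 2 * r ^ 2|) :
    (∃ M T Y : ℝ → ℝ, ScalarCollapse.IsMatched a₀ ts rb a M T Y) ∧
      ∀ M T Y : ℝ → ℝ, ScalarCollapse.IsMatched a₀ ts rb a M T Y →
        ScalarCollapse.CollapsesToNakedSingularity a₀ ts rb φ V M T Y := by
  obtain ⟨δ, hδ, hle⟩ := hfield.le_one_sub hrb haway
  exact ⟨hfield.exists_isMatched hrb hδ hle, fun M T Y hm =>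
    hm.collapsesToNakedSingularity hrb hfield hpressure hδ hle⟩
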